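/- Let $n\ge 0$, $d=n(n-1)/2$, and let $\mathcal C_n$ be the set of non-singular $n\times n$ correlation matrices (real symmetric positive definite matrices with unit diagonal). For an $n\times n$ matrix $M$, let $\mathrm{vec}\,M\in\mathbb R^{n^2}$ be its column-stacking, $\mathrm{vecl}\,M\in\mathbb R^{d}$ the vector of its entries strictly below the diagonal, and $\mathrm{diag}\,M\in\mathbb R^n$ its diagonal. Let $E_l,E_u,E_d$ be the elimination matrices, i.e. the matrices with $\mathrm{vecl}\,M=E_l\,\mathrm{vec}\,M$, $\mathrm{vecl}\,M'=E_u\,\mathrm{vec}\,M$ and $\mathrm{diag}\,M=E_d\,\mathrm{vec}\,M$ for every real $n\times n$ matrix $M$ (a prime denotes the transpose). The map $C\mapsto\gamma(C):=\mathrm{vecl}(\log C)$ is a bijection from $\mathcal C_n$ onto $\mathbb R^{d}$; let $\gamma\mapsto C(\gamma)$ be its inverse and put $\varrho(\gamma):=\mathrm{vecl}\,C(\gamma)$. For every $\gamma\in\mathbb R^d$, let $G=\log C(\gamma)$ and let $A=\partial\,\mathrm{vec}\,C/\partial\,\mathrm{vec}\,G$ be the $n^2\times n^2$ Jacobian matrix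 at $\mathrm{vec}\,G$ of the map $\mathrm{vec}\,M\mapsto \mathrm{vec}(e^{M})$ on all real $n\times n$ matrices $M$. Then this Jacobian exists (that is, the map is differentiable there), the matrix $E_dAE_d'$ is invertible, $\varrho$ is differentiable at $\gamma$, and $$\frac{\partial\varrho}{\partial\gamma}=E_l\Bigl(I-AE_d'\bigl(E_dAE_d'\bigr)^{-1}E_d\Bigr)A\,(E_l+E_u)'.$$ -/

import Mathlib

/-- Index set of the `n (n - 1) / 2` positions `(i, j)` (row, column) strictly below the diagonal of
an `n × n` matrix. -/
abbrev LowerIndex (n : ℕ) : Type := {p : Fin n × Fin n // p.2 < p.1}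

/-- `vecl M`: the vector of the lower off-diagonal entries of `M`. -/
def vecl {n : ℕ} (M : Matrix (Fin n) (Fin n) ℝ) : LowerIndex n → ℝ :=
  fun p => M p.1.1 p.1.2

/-- The inverse of the column-stacking operator `Matrix.vec`, whose index pairs are
`(column, row)`. -/
def unvec {n : ℕ} (v : Fin n × Fin n → ℝ) : Matrix (Fin n) (Fin n) ℝ :=
  Matrix.of fun i j => v (j, i)

theorem vec_unvec {n : ℕ} (v : Fin n × Fin n → ℝ) : (unvec v).vec = v := rfl

theorem unvec_vec {n : ℕ} (M : Matrix (Fin n) (Fin n) ℝ) : unvec M.vec = M := rfl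

/-- The elimination matrix of `vecl`: it picks the entry `M i j`, `j < i`, out of `vec M`. -/
def elimL (n : ℕ) : Matrix (LowerIndex n) (Fin n × Fin n) ℝ :=
  Matrix.of fun p q => if q = (p.1.2, p.1.1) then 1 else 0

/-- The elimination matrix of `M ↦ vecl Mᵀ`: it picks the entry `M j i`, `j < i`, out of
`vec M`. -/
def elimU (n : ℕ) : Matrix (LowerIndex n) (Fin n × Fin n) ℝ :=
  Matrix.of fun p q => if q = (p.1.1, p.1.2) then 1 else 0

/-- The elimination matrix of `diag`: it picks the entry `M i i` out of `vec M`. -/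
def elimD (n : ℕ) : Matrix (Fin n) (Fin n × Fin n) ℝ :=
  Matrix.of fun i q => if q = (i, i) then 1 else 0

theorem elimL_mulVec_vec {n : ℕ} (M : Matrix (Fin n) (Fin n) ℝ) :
    Matrix.mulVec (elimL n) M.vec = vecl M := by
  ext p
  simp [elimL, vecl, Matrix.mulVec, dotProduct]

theorem elimU_mulVec_vec {n : ℕ} (M : Matrix (Fin n) (Fin n) ℝ) :
    Matrix.mulVec (elimU n) M.vec = vecl M.transpose := by
  ext p
  simp [elimU, vecl, Matrix.mulVec, dotProduct]

theorem elimD_mulVec_vec {n : ℕ} (M : Matrix (Fin n) (Fin n) ℝ) :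
    Matrix.mulVec (elimD n) M.vec = M.diag := by
  ext p
  simp [elimD, Matrix.mulVec, dotProduct]

/-- The Jacobian matrix `∂f/∂x` of `f : ℝ^ι → ℝ^κ` at `x` (meaningful where `f` is
differentiable); its entry `(k, i)` is `∂f_k/∂x_i`. -/
noncomputable def jacobian {ι κ : Type*} [Fintype ι] [DecidableEq ι] [Fintype κ]
    (f : (ι → ℝ) → (κ → ℝ)) (x : ι → ℝ) : Matrix κ ι ℝ :=
  LinearMap.toMatrix' (fderiv ℝ f x).toLinearMap

/-- The set of non-singular `n × n` correlation matrices: symmetric positive definite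
with unit diagonal. -/
def corrSet (n : ℕ) : Set (Matrix (Fin n) (Fin n) ℝ) :=
  {C | C.PosDef ∧ ∀ i, C i i = 1}

/-- The logarithm of a symmetric positive definite matrix:
`log (Q diag(λ) Qᵀ) = Q diag(log λ) Qᵀ`. -/
noncomputable def matLog {n : ℕ} (C : Matrix (Fin n) (Fin n) ℝ) : Matrix (Fin n) (Fin n) ℝ :=
  cfc Real.log C

/-- The parametrization `γ(C) = vecl (log C)` of non-singular correlation matrices. -/
noncomputable def gammaOf {n : ℕ} (C : Matrix (Fin n) (Fin n) ℝ) : LowerIndex n → ℝ :=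
  vecl (matLog C)

/-- The inverse mapping `C(γ)`: the non-singular correlation matrix `C` with
`vecl (log C) = γ`. -/
noncomputable def corrOf {n : ℕ} (γ : LowerIndex n → ℝ) : Matrix (Fin n) (Fin n) ℝ :=
  Function.invFunOn gammaOf (corrSet n) γ

/-- The vector of correlations `ϱ = vecl C(γ)` as a function of `γ`. -/
noncomputable def rhoOf {n : ℕ} (γ : LowerIndex n → ℝ) : LowerIndex n → ℝ :=
  vecl (corrOf γ)

/-- The map `vec G ↦ vec (e^G)` on all real `n × n` matrices `G`. -/
noncomputable def vecExp {n : ℕ} (v : Fin n × Fin n → ℝ) : Fin n × Fin n → ℝ :=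
  (NormedSpace.exp (unvec v)).vec

/-- The `n² × n²` matrix `A = ∂ vec C / ∂ vec G`, where `C = e^G`, taken at `G`. -/
noncomputable def expJacobian {n : ℕ} (G : Matrix (Fin n) (Fin n) ℝ) :
    Matrix (Fin n × Fin n) (Fin n × Fin n) ℝ :=
  jacobian vecExp G.vec

/-! Fix the off-diagonal part γ of the logarithm and let its diagonal x vary, with G = `symMat γ x`.
The function x ↦ tr exp G - ∑ xᵢ is continuous and coercive (`Matrix.exp_diag_le`), and at a
minimiser the first-order condition says that exp G has unit diagonal. This gives surjectivity.

The rest relies on strict monotonicity of exp for the trace pairing: tr((B - A)(exp B - exp A)) > 0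
for symmetric A ≠ B, and infinitesimally tr(H · dexp_G(H)) > 0 for symmetric G and H ≠ 0. Diagonal
matrices are trace-orthogonal to matrices with zero diagonal, so the first inequality makes x unique
and the second makes E_d A E_d' invertible. No formula for dexp is needed: both inequalities follow
from `Matrix.exists_trace_exp_sub`.

The implicit function theorem then makes x(γ) differentiable. Differentiating E_d vec C = 1 gives dx
= -(E_d A E_d')⁻¹ E_d A (E_l + E_u)' dγ, which is substituted into the differential of ϱ = E_l vec
C. -/

open Matrix NormedSpace Topology Filter

/-! ### Trace inequalities for the matrix exponential. -/

section NormedMatrix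

open scoped Matrix.Norms.L2Operator

variable {m : Type*} [Fintype m] [DecidableEq m]

theorem Matrix.continuous_exp : Continuous fun M : Matrix m m ℝ => NormedSpace.exp M :=
  let +nondep : NormedAlgebra ℚ (Matrix m m ℝ) := .restrictScalars ℚ ℝ _
  NormedSpace.exp_continuous

theorem Matrix.contDiff_exp : ContDiff ℝ 1 fun M : Matrix m m ℝ => NormedSpace.exp M :=
  contDiff_iff_contDiffAt.2 fun M => (NormedSpace.exp_analytic (𝕂 := ℝ) M).contDiffAt

theorem Matrix.exp_eq_conjTranspose_mul_self {A : Matrix m m ℝ} (hA : A.IsHermitian) :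
    NormedSpace.exp A
      = (NormedSpace.exp ((1 / 2 : ℝ) • A))ᴴ * NormedSpace.exp ((1 / 2 : ℝ) • A) := by
  rw [← Matrix.exp_conjTranspose, Matrix.conjTranspose_smul, hA.eq, star_trivial,
    ← Matrix.exp_add_of_commute _ _ (Commute.refl _), ← add_smul]
  norm_num

theorem Matrix.posDef_exp {A : Matrix m m ℝ} (hA : A.IsHermitian) :
    (NormedSpace.exp A).PosDef := by
  rw [Matrix.exp_eq_conjTranspose_mul_self hA]
  exact Matrix.PosDef.conjTranspose_mul_self _
    (Matrix.mulVec_injective_of_isUnit (Matrix.isUnit_exp _))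

theorem Matrix.cfc_log_exp {A : Matrix m m ℝ} (hA : A.IsHermitian) :
    cfc Real.log (NormedSpace.exp A) = A :=
  CFC.log_exp A hA.isSelfAdjoint

open scoped MatrixOrder in
theorem Matrix.exp_cfc_log {A : Matrix m m ℝ} (hA : A.PosDef) :
    NormedSpace.exp (cfc Real.log A) = A :=
  CFC.exp_log A hA.isStrictlyPositive

open scoped MatrixOrder in
-- The tangent line of the scalar exponential at a = `A i i` lies below it. The functional calculus
-- lifts this to the Loewner order, and the i-th diagonal entry of the lifted tangent line is
-- exactly e^a.
theorem Matrix.exp_diag_le {A : Matrix m m ℝ} (hA : A.IsHermitian) (i : m) :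
    Real.exp (A i i) ≤ NormedSpace.exp A i i := by
  have hs : IsSelfAdjoint A := hA.isSelfAdjoint
  set a := A i i
  have h : cfc (fun x : ℝ => Real.exp a * (1 - a) + Real.exp a * x) A ≤ cfc Real.exp A := by
    refine cfc_mono (fun x _ => ?_)
    have h1 := Real.add_one_le_exp (x - a)
    have h2 : Real.exp x = Real.exp a * Real.exp (x - a) := by rw [← Real.exp_add]; ring_nf
    rw [h2]
    nlinarith [Real.exp_pos a]
  rw [CFC.real_exp_eq_normedSpace_exp hs, cfc_const_add _ _ _, cfc_const_mul _ _ _,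
    cfc_id' ℝ A, Matrix.le_iff] at h
  have h3 := h.diag_nonneg (i := i)
  simp only [Matrix.sub_apply, Matrix.add_apply, Matrix.smul_apply, Algebra.algebraMap_eq_smul_one,
    Matrix.one_apply_eq, smul_eq_mul] at h3
  change 0 ≤ _ - (_ + _ * a) at h3
  linarith

/-- A mean value formula for `t ↦ exp ((1 - t) A) exp (t B)`. -/
theorem Matrix.exists_trace_exp_sub (K A B : Matrix m m ℝ) :
    ∃ s ∈ Set.Icc (0 : ℝ) 1, (K * (NormedSpace.exp B - NormedSpace.exp A)).trace =
      (K * (NormedSpace.exp ((1 - s) • A) * (B - A) * NormedSpace.exp (s • B))).trace := by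
  let T : Matrix m m ℝ →L[ℝ] ℝ :=
    LinearMap.toContinuousLinearMap (Matrix.traceLinearMap m ℝ ℝ ∘ₗ LinearMap.mulLeft ℝ K)
  have hd : ∀ s : ℝ, HasDerivAt
      (fun s : ℝ => T (NormedSpace.exp ((1 - s) • A) * NormedSpace.exp (s • B)))
      (T (NormedSpace.exp ((1 - s) • A) * (B - A) * NormedSpace.exp (s • B))) s := by
    intro s
    -- The derivative of the first factor is written with A on its right, that of the second with B
    -- on its left, so the two terms combine to B - A between the exponentials.
    have h1 := (hasDerivAt_exp_smul_const A (1 - s)).scomp s ((hasDerivAt_id s).const_sub 1)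
    have h2 := hasDerivAt_exp_smul_const' B s
    have h3 := T.hasFDerivAt.comp_hasDerivAt s (h1.mul h2)
    convert! h3 using 2
    simp only [Function.comp_apply, neg_one_smul]
    noncomm_ring
  obtain ⟨s, hs, h⟩ := exists_hasDerivAt_eq_slope _ _ (zero_lt_one (α := ℝ))
    (fun s _ => (hd s).continuousAt.continuousWithinAt) (fun s _ => hd s)
  refine ⟨s, Set.Ioo_subset_Icc_self hs, ?_⟩
  have h' : T (NormedSpace.exp ((1 - s) • A) * (B - A) * NormedSpace.exp (s • B)) =
      T (NormedSpace.exp B - NormedSpace.exp A) := by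
    rw [h]; simp
  exact h'.symm

/-- Writing exp A = SᴴS and exp B = RᴴR, cyclicity turns the trace into the squared Frobenius norm
of S H Rᴴ, which is nonzero because S and R are invertible. -/
theorem Matrix.trace_mul_exp_mul_mul_exp_pos {H A B : Matrix m m ℝ} (hH : H.IsHermitian)
    (hH0 : H ≠ 0) (hA : A.IsHermitian) (hB : B.IsHermitian) :
    0 < (H * (NormedSpace.exp A * H * NormedSpace.exp B)).trace := by
  rw [Matrix.exp_eq_conjTranspose_mul_self hA, Matrix.exp_eq_conjTranspose_mul_self hB]
  have hS := Matrix.isUnit_exp ((1 / 2 : ℝ) • A)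
  have hR := Matrix.isUnit_exp ((1 / 2 : ℝ) • B)
  set S := NormedSpace.exp ((1 / 2 : ℝ) • A)
  set R := NormedSpace.exp ((1 / 2 : ℝ) • B)
  have hRt : IsUnit Rᴴ := hR.star
  have key : (H * (Sᴴ * S * H * (Rᴴ * R))).trace = ((S * H * Rᴴ)ᴴ * (S * H * Rᴴ)).trace := by
    simp only [Matrix.conjTranspose_mul, Matrix.conjTranspose_conjTranspose, hH.eq]
    rw [show H * (Sᴴ * S * H * (Rᴴ * R)) = (H * Sᴴ * S * H * Rᴴ) * R by noncomm_ring,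
      Matrix.trace_mul_comm]
    congr 1
    noncomm_ring
  rw [key]
  refine lt_of_le_of_ne (Matrix.posSemidef_conjTranspose_mul_self _).trace_nonneg fun h0 => hH0 ?_
  have h1 := Matrix.trace_conjTranspose_mul_self_eq_zero_iff.1 h0.symm
  exact (hS.mul_right_eq_zero).1 ((hRt.mul_left_eq_zero).1 h1)

theorem Matrix.continuous_expPath (K A H : Matrix m m ℝ) : Continuous fun p : ℝ × ℝ =>
    (K * (NormedSpace.exp ((1 - p.2) • A) * H * NormedSpace.exp (p.2 • (A + p.1 • H)))).trace := by
  have hc := Matrix.continuous_exp (m := m)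
  have h1 : Continuous fun p : ℝ × ℝ => NormedSpace.exp ((1 - p.2) • A) :=
    hc.comp (by fun_prop)
  have h2 : Continuous fun p : ℝ × ℝ => NormedSpace.exp (p.2 • (A + p.1 • H)) :=
    hc.comp (by fun_prop)
  fun_prop

/-- If the derivative at `A` of `M ↦ tr (K exp M)` in direction `H`, computed
by moving `exp` factors along a segment, lies in an open set `U` for every splitting, then so do
all the nearby difference quotients. -/
theorem Matrix.eventually_trace_exp_slope_mem {K A H : Matrix m m ℝ} {U : Set ℝ} (hU : IsOpen U)
    (h : ∀ s ∈ Set.Icc (0 : ℝ) 1,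
      (K * (NormedSpace.exp ((1 - s) • A) * H * NormedSpace.exp (s • A))).trace ∈ U) :
    ∀ᶠ t : ℝ in 𝓝[≠] 0,
      t⁻¹ * (K * (NormedSpace.exp (A + t • H) - NormedSpace.exp A)).trace ∈ U := by
  have hc := Matrix.continuous_expPath K A H
  -- The mean value point s depends on t, so membership must hold for all s at once when t is small;
  -- compactness of [0, 1] provides this.
  have := isCompact_Icc.eventually_forall_of_forall_eventually (x₀ := (0 : ℝ))
    (K := Set.Icc (0 : ℝ) 1)
    (P := fun t s => (K * (NormedSpace.exp ((1 - s) • A) * H *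
      NormedSpace.exp (s • (A + t • H)))).trace ∈ U)
    (fun s hs => hc.continuousAt.eventually (hU.mem_nhds (by simpa using h s hs)))
  filter_upwards [this.filter_mono nhdsWithin_le_nhds, self_mem_nhdsWithin] with t ht ht0
  obtain ⟨s, hs, hs'⟩ := Matrix.exists_trace_exp_sub K A (A + t • H)
  have h2 := ht s hs
  rw [hs']
  convert h2 using 1
  rw [add_sub_cancel_left, Matrix.mul_smul, Matrix.smul_mul, Matrix.mul_smul, Matrix.trace_smul,
    smul_eq_mul, inv_mul_cancel_left₀ ht0]

theorem Matrix.trace_mul_exp_sub_pos {A B : Matrix m m ℝ} (hA : A.IsHermitian)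
    (hB : B.IsHermitian) (h : A ≠ B) :
    0 < ((B - A) * (NormedSpace.exp B - NormedSpace.exp A)).trace := by
  obtain ⟨s, -, hs⟩ := Matrix.exists_trace_exp_sub (B - A) A B
  rw [hs]
  exact Matrix.trace_mul_exp_mul_mul_exp_pos (hB.sub hA) (sub_ne_zero.2 h.symm)
    (hA.smul (IsSelfAdjoint.all _)) (hB.smul (IsSelfAdjoint.all _))

/-- A uniform bound c is needed because positivity alone could be lost in the limit t → 0. Half the
minimum over the compact range of splittings s serves. -/
theorem Matrix.exists_eventually_lt_trace_exp_slope {A H : Matrix m m ℝ} (hA : A.IsHermitian)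
    (hH : H.IsHermitian) (hH0 : H ≠ 0) :
    ∃ c > 0, ∀ᶠ t : ℝ in 𝓝[≠] 0,
      c < t⁻¹ * (H * (NormedSpace.exp (A + t • H) - NormedSpace.exp A)).trace := by
  have hc : Continuous fun s : ℝ =>
      (H * (NormedSpace.exp ((1 - s) • A) * H * NormedSpace.exp (s • A))).trace := by
    simpa [Function.comp_def] using (Matrix.continuous_expPath H A H).comp (Continuous.prodMk_right (0 : ℝ))
  obtain ⟨s₀, -, hmin⟩ := isCompact_Icc.exists_isMinOn (Set.nonempty_Icc.2 zero_le_one)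
    hc.continuousOn
  have hpos := Matrix.trace_mul_exp_mul_mul_exp_pos hH hH0
    (hA.smul (IsSelfAdjoint.all (1 - s₀))) (hA.smul (IsSelfAdjoint.all s₀))
  refine ⟨_, half_pos hpos, Matrix.eventually_trace_exp_slope_mem isOpen_Ioi fun s hs => ?_⟩
  exact (half_lt_self hpos).trans_le (hmin hs)

/-- One half of Fermat's rule, obtained along t > 0. With K = 1, cyclicity makes every splitting
equal to tr(exp A · H), so no choice of s matters. -/
theorem Matrix.trace_exp_mul_le_of_isMin {A H : Matrix m m ℝ} {c : ℝ}
    (h : ∀ t : ℝ, t * c ≤ (NormedSpace.exp (A + t • H)).trace - (NormedSpace.exp A).trace) :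
    c ≤ (NormedSpace.exp A * H).trace := by
  by_contra! hlt
  have hev := Matrix.eventually_trace_exp_slope_mem (K := 1) (A := A) (H := H)
    (isOpen_Iio (a := c)) fun s _ => by
      rw [one_mul, Matrix.trace_mul_comm, ← mul_assoc, ← Matrix.exp_add_of_commute, ← add_smul]
      · simpa using hlt
      · exact (Commute.refl A).smul_left _ |>.smul_right _
  obtain ⟨t, ht, ht0⟩ :=
    ((hev.filter_mono (nhdsGT_le_nhdsNE 0)).and
      (self_mem_nhdsWithin (s := Set.Ioi (0 : ℝ)))).exists
  have ht0 : 0 < t := ht0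
  rw [one_mul, Matrix.trace_sub, Set.mem_Iio, inv_mul_lt_iff₀ ht0] at ht
  exact absurd (h t) ht.not_ge

end NormedMatrix

/-! ### Symmetric matrices in off-diagonal and diagonal coordinates. -/

variable {n : ℕ}

/-- The symmetric matrix with off-diagonal entries `γ` and diagonal `x`. -/
noncomputable def symMat (γ : LowerIndex n → ℝ) (x : Fin n → ℝ) : Matrix (Fin n) (Fin n) ℝ :=
  unvec ((elimL n + elimU n)ᵀ *ᵥ γ + (elimD n)ᵀ *ᵥ x)

theorem elimL_add_elimU_transpose_mulVec_apply (γ : LowerIndex n → ℝ) (i j : Fin n) :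
    ((elimL n + elimU n)ᵀ *ᵥ γ) (j, i) =
      if h : j < i then γ ⟨(i, j), h⟩ else if h : i < j then γ ⟨(j, i), h⟩ else 0 := by
  simp only [mulVec, dotProduct, transpose_apply, Matrix.add_apply, elimL, elimU, of_apply, Prod.mk.injEq]
  split_ifs with h1 h2
  · rw [Finset.sum_eq_single ⟨(i, j), h1⟩]
    · simp [h1.ne]
    · rintro ⟨⟨a, b⟩, hab⟩ - hne
      have : ¬ (j = b ∧ i = a) := by rintro ⟨rfl, rfl⟩; exact hne rfl
      have : ¬ (j = a ∧ i = b) := by rintro ⟨rfl, rfl⟩; exact lt_asymm h1 hab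
      simp [*]
    · simp
  · rw [Finset.sum_eq_single ⟨(j, i), h2⟩]
    · simp [h2.ne, h2.ne']
    · rintro ⟨⟨a, b⟩, hab⟩ - hne
      have : ¬ (j = b ∧ i = a) := by rintro ⟨rfl, rfl⟩; exact lt_asymm h2 hab
      have : ¬ (j = a ∧ i = b) := by rintro ⟨rfl, rfl⟩; exact hne rfl
      simp [*]
    · simp
  · refine Finset.sum_eq_zero ?_
    rintro ⟨⟨a, b⟩, hab⟩ -
    have : ¬ (j = b ∧ i = a) := by rintro ⟨rfl, rfl⟩; exact h1 hab
    have : ¬ (j = a ∧ i = b) := by rintro ⟨rfl, rfl⟩; exact h2 hab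
    simp [*]

theorem elimD_transpose_mulVec (x : Fin n → ℝ) : (elimD n)ᵀ *ᵥ x = (diagonal x).vec := by
  ext ⟨j, i⟩
  simp only [mulVec, dotProduct, transpose_apply, elimD, of_apply, Prod.mk.injEq, vec,
    diagonal_apply]
  split_ifs with h
  · subst h; simp
  · refine Finset.sum_eq_zero fun k _ => ?_
    have : ¬ (j = k ∧ i = k) := by rintro ⟨rfl, rfl⟩; exact h rfl
    simp [this]

theorem symMat_apply (γ : LowerIndex n → ℝ) (x : Fin n → ℝ) (i j : Fin n) :
    symMat γ x i j = if h : j < i then γ ⟨(i, j), h⟩ else if h : i < j then γ ⟨(j, i), h⟩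
      else x i := by
  change ((elimL n + elimU n)ᵀ *ᵥ γ) (j, i) + ((elimD n)ᵀ *ᵥ x) (j, i) = _
  rw [elimL_add_elimU_transpose_mulVec_apply, elimD_transpose_mulVec]
  simp only [vec, diagonal_apply]
  split_ifs <;> first | omega | simp

theorem isHermitian_symMat (γ : LowerIndex n → ℝ) (x : Fin n → ℝ) :
    (symMat γ x).IsHermitian := by
  ext i j
  simp only [conjTranspose_apply, star_trivial, symMat_apply]
  split_ifs <;> first | omega | rfl | (congr 1; omega)

theorem vecl_symMat (γ : LowerIndex n → ℝ) (x : Fin n → ℝ) : vecl (symMat γ x) = γ := by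
  ext ⟨⟨i, j⟩, h⟩
  have h : j < i := h
  simp [vecl, symMat_apply, h]

theorem symMat_vecl_diag {M : Matrix (Fin n) (Fin n) ℝ} (hM : M.IsHermitian) :
    symMat (vecl M) M.diag = M := by
  ext i j
  rw [symMat_apply]
  split_ifs
  · rfl
  · exact hM.apply i j
  · obtain rfl : i = j := by omega
    rfl

theorem symMat_add_smul (γ : LowerIndex n → ℝ) (x h : Fin n → ℝ) (t : ℝ) :
    symMat γ (x + t • h) = symMat γ x + t • diagonal h := by
  rw [symMat, mulVec_add, mulVec_smul, ← add_assoc, elimD_transpose_mulVec h]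
  rfl

theorem continuous_symMat (γ : LowerIndex n → ℝ) : Continuous (symMat γ) := by
  refine continuous_matrix fun i j => ?_
  simp only [symMat_apply]
  split_ifs <;> fun_prop

/-! ### Existence and uniqueness of the diagonal: the bijection γ. -/

/-- The function `x ↦ tr exp (symMat γ x) - ∑ xᵢ` attains its minimum, and there
`exp (symMat γ x)` has unit diagonal. -/
theorem exists_exp_symMat_mem_corrSet (γ : LowerIndex n → ℝ) :
    ∃ x, NormedSpace.exp (symMat γ x) ∈ corrSet n := by
  let f : (Fin n → ℝ) → ℝ := fun x => (NormedSpace.exp (symMat γ x)).trace - ∑ i, x i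
  have hf : Continuous f :=
    ((Matrix.continuous_exp.comp (continuous_symMat γ)).matrix_trace).sub (by fun_prop)
  -- Coercivity, coordinate by coordinate: 2y ≤ e^y gives |y| ≤ e^y - y, and e^{xᵢ} is at most the
  -- i-th diagonal entry of the exponential.
  have hlow : ∀ x, ‖x‖ ≤ f x := by
    intro x
    have h1 : ∀ i, |x i| ≤ NormedSpace.exp (symMat γ x) i i - x i := by
      intro i
      have h2 := Matrix.exp_diag_le (isHermitian_symMat γ x) i
      rw [show symMat γ x i i = x i by simp [symMat_apply]] at h2
      have h3 : 2 * x i ≤ Real.exp (x i) := by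
        -- For y ≥ 0, e^y = (e^{y/2})² ≥ (1 + y/2)² = 2y + (y/2 - 1)².
        have h4 := Real.add_one_le_exp (x i / 2)
        have h5 : Real.exp (x i) = Real.exp (x i / 2) ^ 2 := by
          rw [← Real.exp_nat_mul]; ring_nf
        rw [h5]
        by_cases hx : 0 ≤ x i
        · nlinarith [sq_nonneg (x i / 2 - 1)]
        · nlinarith [sq_nonneg (Real.exp (x i / 2))]
      have h6 := Real.exp_pos (x i)
      rw [abs_le']
      constructor <;> linarith
    have h7 : ∑ i, |x i| ≤ f x := by
      simp only [f, Matrix.trace, Matrix.diag, ← Finset.sum_sub_distrib]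
      exact Finset.sum_le_sum fun i _ => h1 i
    refine le_trans ((pi_norm_le_iff_of_nonneg (by positivity)).2 fun i => ?_) h7
    exact Finset.single_le_sum (f := fun i => |x i|) (fun i _ => abs_nonneg _) (Finset.mem_univ i)
  obtain ⟨x, hx⟩ := hf.exists_forall_le
    (tendsto_atTop_mono hlow (tendsto_norm_cocompact_atTop (E := Fin n → ℝ)))
  have hcrit : ∀ h : Fin n → ℝ,
      ∑ i, h i ≤ (NormedSpace.exp (symMat γ x) * diagonal h).trace := by
    intro h
    refine Matrix.trace_exp_mul_le_of_isMin fun t => ?_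
    have := hx (x + t • h)
    simp only [f, symMat_add_smul, Pi.add_apply, Pi.smul_apply, smul_eq_mul,
      Finset.sum_add_distrib, ← Finset.mul_sum] at this
    linarith
  refine ⟨x, Matrix.posDef_exp (isHermitian_symMat γ x), fun i => ?_⟩
  -- Opposite coordinate directions turn the one-sided condition into equality.
  have h1 := hcrit (Pi.single i 1)
  have h2 := hcrit (Pi.single i (-1))
  simp only [Matrix.trace, Matrix.diag, Matrix.mul_diagonal, Pi.single_apply, mul_ite, mul_one,
    mul_neg, mul_zero, Finset.sum_ite_eq', Finset.mem_univ, if_true] at h1 h2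
  linarith

theorem trace_mul_eq_zero_of_offDiag_of_diag {H D : Matrix (Fin n) (Fin n) ℝ}
    (hH : ∀ i j, i ≠ j → H i j = 0) (hD : ∀ i, D i i = 0) : (H * D).trace = 0 := by
  refine Finset.sum_eq_zero fun i _ =>
    (Matrix.mul_apply ..).trans (Finset.sum_eq_zero fun j _ => ?_)
  by_cases h : i = j
  · subst h; simp [hD]
  · simp [hH i j h]

theorem isHermitian_matLog (C : Matrix (Fin n) (Fin n) ℝ) : (matLog C).IsHermitian :=
  cfc_predicate (p := IsSelfAdjoint) Real.log C

/-- For injectivity, equal γ makes the difference of the logarithms diagonal, while the difference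
of the correlation matrices has zero diagonal. Their trace pairing vanishes, against strict
monotonicity of exp. -/
theorem bijOn_gammaOf : Set.BijOn (gammaOf (n := n)) (corrSet n) Set.univ := by
  refine ⟨Set.mapsTo_univ _ _, ?_, ?_⟩
  · intro C hC D hD hCD
    have hC' : NormedSpace.exp (matLog C) = C := Matrix.exp_cfc_log hC.1
    have hD' : NormedSpace.exp (matLog D) = D := Matrix.exp_cfc_log hD.1
    by_contra hne
    have hne' : matLog C ≠ matLog D := fun h => hne (by rw [← hC', ← hD', h])
    have hpos := Matrix.trace_mul_exp_sub_pos (isHermitian_matLog C) (isHermitian_matLog D) hne'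
    rw [hC', hD', trace_mul_eq_zero_of_offDiag_of_diag] at hpos
    · exact hpos.false
    · intro i j hij
      rw [Matrix.sub_apply, ← symMat_vecl_diag (isHermitian_matLog C),
        ← symMat_vecl_diag (isHermitian_matLog D), symMat_apply, symMat_apply,
        show vecl (matLog C) = vecl (matLog D) from hCD]
      split_ifs <;> first | omega | simp
    · intro i
      simp [hC.2 i, hD.2 i]
  · intro γ _
    obtain ⟨x, hx⟩ := exists_exp_symMat_mem_corrSet γ
    refine ⟨_, hx, ?_⟩
    rw [gammaOf, matLog, Matrix.cfc_log_exp (isHermitian_symMat γ x), vecl_symMat]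

theorem corrOf_mem (γ : LowerIndex n → ℝ) : corrOf γ ∈ corrSet n :=
  Function.invFunOn_mem (bijOn_gammaOf.surjOn (Set.mem_univ γ))

theorem gammaOf_corrOf (γ : LowerIndex n → ℝ) : gammaOf (corrOf γ) = γ :=
  Function.invFunOn_eq (bijOn_gammaOf.surjOn (Set.mem_univ γ))

/-- The diagonal of `log C(γ)`. -/
noncomputable def logDiag (γ : LowerIndex n → ℝ) : Fin n → ℝ :=
  (matLog (corrOf γ)).diag

theorem matLog_corrOf (γ : LowerIndex n → ℝ) : matLog (corrOf γ) = symMat γ (logDiag γ) := by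
  conv_rhs => rw [← gammaOf_corrOf γ]
  rw [logDiag, gammaOf_corrOf]
  conv_lhs => rw [← symMat_vecl_diag (isHermitian_matLog (corrOf γ))]
  rw [show vecl (matLog (corrOf γ)) = γ from gammaOf_corrOf γ]

theorem corrOf_eq (γ : LowerIndex n → ℝ) :
    corrOf γ = NormedSpace.exp (symMat γ (logDiag γ)) := by
  rw [← matLog_corrOf]
  exact (Matrix.exp_cfc_log (corrOf_mem γ).1).symm

/-- Global uniqueness of the diagonal; it later identifies a local implicit function with `logDiag`.
-/
theorem eq_logDiag {γ : LowerIndex n → ℝ} {x : Fin n → ℝ}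
    (h : ∀ i, NormedSpace.exp (symMat γ x) i i = 1) : x = logDiag γ := by
  have hmem : NormedSpace.exp (symMat γ x) ∈ corrSet n :=
    ⟨Matrix.posDef_exp (isHermitian_symMat γ x), h⟩
  have hγ : gammaOf (NormedSpace.exp (symMat γ x)) = γ := by
    rw [gammaOf, matLog, Matrix.cfc_log_exp (isHermitian_symMat γ x), vecl_symMat]
  have heq : NormedSpace.exp (symMat γ x) = corrOf γ :=
    bijOn_gammaOf.injOn hmem (corrOf_mem γ) (hγ.trans (gammaOf_corrOf γ).symm)
  rw [logDiag, ← heq, matLog, Matrix.cfc_log_exp (isHermitian_symMat γ x)]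
  ext i
  simp [symMat_apply]

/-! ### The Jacobian of the exponential and its positivity. -/

section VecExp

open scoped Matrix.Norms.L2Operator

theorem contDiff_vecExp : ContDiff ℝ 1 (vecExp (n := n)) := by
  let U : (Fin n × Fin n → ℝ) →L[ℝ] Matrix (Fin n) (Fin n) ℝ :=
    LinearMap.toContinuousLinearMap
      { toFun := unvec, map_add' := fun _ _ => rfl, map_smul' := fun _ _ => rfl }
  let V : Matrix (Fin n) (Fin n) ℝ →L[ℝ] (Fin n × Fin n → ℝ) :=
    LinearMap.toContinuousLinearMap
      { toFun := Matrix.vec, map_add' := fun _ _ => rfl, map_smul' := fun _ _ => rfl }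
  exact V.contDiff.comp (Matrix.contDiff_exp.comp U.contDiff)

end VecExp

/-- Multiplication by a real matrix, as a continuous linear map. -/
noncomputable def Matrix.mulVecCLM {ι κ : Type*} [Fintype ι] (M : Matrix κ ι ℝ) :
    (ι → ℝ) →L[ℝ] (κ → ℝ) where
  toLinearMap := M.mulVecLin
  cont := Continuous.matrix_mulVec continuous_const continuous_id

@[simp]
theorem Matrix.mulVecCLM_apply {ι κ : Type*} [Fintype ι] (M : Matrix κ ι ℝ) (v : ι → ℝ) :
    M.mulVecCLM v = M *ᵥ v := rfl

theorem mulVecCLM_jacobian {ι κ : Type*} [Fintype ι] [DecidableEq ι] [Fintype κ]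
    (f : (ι → ℝ) → (κ → ℝ)) (x : ι → ℝ) : (jacobian f x).mulVecCLM = fderiv ℝ f x := by
  ext1 v
  rw [Matrix.mulVecCLM_apply, jacobian, LinearMap.toMatrix'_mulVec]
  rfl

theorem jacobian_eq_of_hasFDerivAt {ι κ : Type*} [Fintype ι] [DecidableEq ι] [Fintype κ]
    {f : (ι → ℝ) → (κ → ℝ)} {x : ι → ℝ} {M : Matrix κ ι ℝ} (h : HasFDerivAt f M.mulVecCLM x) :
    jacobian f x = M := by
  rw [jacobian, h.fderiv]
  exact LinearMap.toMatrix'_toLin' M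

theorem hasStrictFDerivAt_vecExp (G : Matrix (Fin n) (Fin n) ℝ) :
    HasStrictFDerivAt vecExp (expJacobian G).mulVecCLM G.vec := by
  rw [expJacobian, mulVecCLM_jacobian]
  exact contDiff_vecExp.contDiffAt.hasStrictFDerivAt one_ne_zero

/-- The pairing is the limit of difference quotients that eventually exceed a fixed c > 0. -/
theorem trace_mul_expJacobian_pos {G H : Matrix (Fin n) (Fin n) ℝ} (hG : G.IsHermitian)
    (hH : H.IsHermitian) (hH0 : H ≠ 0) :
    0 < (H * unvec (expJacobian G *ᵥ H.vec)).trace := by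
  obtain ⟨c, hc, hev⟩ := Matrix.exists_eventually_lt_trace_exp_slope hG hH hH0
  have hlim : Tendsto (fun t : ℝ => t⁻¹ • (vecExp (G.vec + t • H.vec) - vecExp G.vec)) (𝓝[≠] 0)
      (𝓝 (expJacobian G *ᵥ H.vec)) :=
    ((hasStrictFDerivAt_vecExp G).hasFDerivAt.hasLineDerivAt H.vec).tendsto_slope_zero
  have hcont : Continuous fun v : Fin n × Fin n → ℝ => (H * unvec v).trace := by
    refine (continuous_const.matrix_mul ?_).matrix_trace
    exact continuous_matrix fun i j => continuous_apply (j, i)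
  refine hc.trans_le (ge_of_tendsto ((hcont.tendsto _).comp hlim) ?_)
  filter_upwards [hev] with t ht
  refine ht.le.trans_eq ?_
  change _ = (H * (t⁻¹ • (NormedSpace.exp (G + t • H) - NormedSpace.exp G))).trace
  rw [Matrix.mul_smul, Matrix.trace_smul, smul_eq_mul]

/-- If h is in the kernel, the derivative of exp in direction diag h has zero diagonal, so its trace
pairing with diag h is 0. Positivity of that pairing forces h = 0. -/
theorem isUnit_elimD_mul_expJacobian_mul {G : Matrix (Fin n) (Fin n) ℝ} (hG : G.IsHermitian) :
    IsUnit (elimD n * expJacobian G * (elimD n)ᵀ) := by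
  rw [← Matrix.mulVec_injective_iff_isUnit]
  refine (injective_iff_map_eq_zero (elimD n * expJacobian G * (elimD n)ᵀ).mulVecLin).2 ?_
  intro h hh
  by_contra h0
  have hd : (diagonal h : Matrix (Fin n) (Fin n) ℝ) ≠ 0 := by
    simpa using h0
  have hpos := trace_mul_expJacobian_pos hG (isHermitian_diagonal h) hd
  rw [Matrix.mulVecLin_apply, ← Matrix.mulVec_mulVec, elimD_transpose_mulVec,
    ← Matrix.mulVec_mulVec, ← vec_unvec (expJacobian G *ᵥ _), elimD_mulVec_vec] at hh
  rw [trace_mul_eq_zero_of_offDiag_of_diag] at hpos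
  · exact hpos.false
  · exact fun i j hij => diagonal_apply_ne _ hij
  · exact fun i => congrFun hh i

/-! ### Implicit differentiation of the unit-diagonal constraint. -/

theorem vec_symMat (γ : LowerIndex n → ℝ) (x : Fin n → ℝ) :
    (symMat γ x).vec = (elimL n + elimU n)ᵀ *ᵥ γ + (elimD n)ᵀ *ᵥ x := rfl

theorem vecExp_symMat (γ : LowerIndex n → ℝ) (x : Fin n → ℝ) :
    vecExp ((elimL n + elimU n)ᵀ *ᵥ γ + (elimD n)ᵀ *ᵥ x) =
      (NormedSpace.exp (symMat γ x)).vec := rfl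

theorem elimD_mulVec_vecExp_logDiag (γ : LowerIndex n → ℝ) :
    elimD n *ᵥ vecExp ((elimL n + elimU n)ᵀ *ᵥ γ + (elimD n)ᵀ *ᵥ logDiag γ) = 1 := by
  rw [vecExp_symMat, elimD_mulVec_vec, ← corrOf_eq]
  exact funext (corrOf_mem γ).2

theorem elimL_mulVec_vecExp_logDiag (γ : LowerIndex n → ℝ) :
    elimL n *ᵥ vecExp ((elimL n + elimU n)ᵀ *ᵥ γ + (elimD n)ᵀ *ᵥ logDiag γ) = rhoOf γ := by
  rw [vecExp_symMat, elimL_mulVec_vec, ← corrOf_eq]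
  rfl

theorem Matrix.isInvertible_mulVecCLM {ι : Type*} [Fintype ι] [DecidableEq ι]
    {M : Matrix ι ι ℝ} (hM : IsUnit M) : M.mulVecCLM.IsInvertible := by
  have hdet := (Matrix.isUnit_iff_isUnit_det M).1 hM
  refine ⟨ContinuousLinearEquiv.equivOfInverse M.mulVecCLM M⁻¹.mulVecCLM ?_ ?_, rfl⟩ <;> intro v
  · simp [Matrix.mulVec_mulVec, Matrix.nonsing_inv_mul _ hdet]
  · simp [Matrix.mulVec_mulVec, Matrix.mul_nonsing_inv _ hdet]

/-- The implicit function theorem applies to E_d vec exp(`symMat γ x`) = 1, whose partial derivative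
in x is the invertible matrix E_d A E_d'. Near γ the implicit function solves the constraint, hence
equals `logDiag` by uniqueness. -/
theorem differentiableAt_logDiag (γ : LowerIndex n → ℝ) : DifferentiableAt ℝ logDiag γ := by
  let P := (elimL n + elimU n)ᵀ.mulVecCLM
  let Q := (elimD n)ᵀ.mulVecCLM
  let A := expJacobian (symMat γ (logDiag γ))
  have hF : HasStrictFDerivAt
      (fun u : (LowerIndex n → ℝ) × (Fin n → ℝ) => elimD n *ᵥ vecExp (P u.1 + Q u.2))
      ((elimD n).mulVecCLM ∘L A.mulVecCLM ∘L (P ∘L .fst ℝ _ _ + Q ∘L .snd ℝ _ _))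
      (γ, logDiag γ) := by
    have h1 := (P ∘L .fst ℝ _ (Fin n → ℝ) + Q ∘L .snd ℝ (LowerIndex n → ℝ) _).hasStrictFDerivAt
      (x := (γ, logDiag γ))
    have h2 := hasStrictFDerivAt_vecExp (symMat γ (logDiag γ))
    rw [vec_symMat] at h2
    exact (elimD n).mulVecCLM.hasStrictFDerivAt.comp _ (h2.comp (γ, logDiag γ) h1)
  have hinv : (((elimD n).mulVecCLM ∘L A.mulVecCLM ∘L (P ∘L .fst ℝ _ _ + Q ∘L .snd ℝ _ _)) ∘L
      .inr ℝ (LowerIndex n → ℝ) (Fin n → ℝ)).IsInvertible := by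
    convert Matrix.isInvertible_mulVecCLM
      (isUnit_elimD_mul_expJacobian_mul (isHermitian_symMat γ (logDiag γ))) using 1
    ext1 v
    simp [P, Q, A, Matrix.mulVec_mulVec, Matrix.mul_assoc]
  have hψ := hF.hasStrictFDerivAt_implicitFunctionOfProdDomain hinv
  refine (hψ.hasFDerivAt.differentiableAt).congr_of_eventuallyEq ?_
  filter_upwards [hF.eventually_apply_implicitFunctionOfProdDomain hinv] with δ hδ
  refine (eq_logDiag fun i => ?_).symm
  have h1 : elimD n *ᵥ (NormedSpace.exp
      (symMat δ (hF.implicitFunctionOfProdDomain hinv δ))).vec = 1 :=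
    hδ.trans (elimD_mulVec_vecExp_logDiag γ)
  rw [elimD_mulVec_vec] at h1
  exact congrFun h1 i

theorem hasFDerivAt_rhoOf (γ : LowerIndex n → ℝ) :
    HasFDerivAt rhoOf
      (elimL n *
          (1 - expJacobian (matLog (corrOf γ)) * (elimD n)ᵀ *
            (elimD n * expJacobian (matLog (corrOf γ)) * (elimD n)ᵀ)⁻¹ * elimD n) *
          expJacobian (matLog (corrOf γ)) * (elimL n + elimU n)ᵀ).mulVecCLM γ := by
  have hG := isHermitian_matLog (corrOf γ)
  rw [matLog_corrOf] at hG ⊢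
  have hdet := (Matrix.isUnit_iff_isUnit_det _).1 (isUnit_elimD_mul_expJacobian_mul hG)
  have hexp := (hasStrictFDerivAt_vecExp (symMat γ (logDiag γ))).hasFDerivAt
  rw [vec_symMat] at hexp
  set A := expJacobian (symMat γ (logDiag γ))
  set P := (elimL n + elimU n)ᵀ
  set E := elimD n
  have hx := (differentiableAt_logDiag γ).hasFDerivAt
  set X := fderiv ℝ logDiag γ
  have hv : HasFDerivAt (fun γ => vecExp (P *ᵥ γ + Eᵀ *ᵥ logDiag γ))
      (A.mulVecCLM ∘L (P.mulVecCLM + Eᵀ.mulVecCLM ∘L X)) γ :=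
    HasFDerivAt.comp (g := vecExp) (f := fun γ => P *ᵥ γ + Eᵀ *ᵥ logDiag γ) γ hexp
      (P.mulVecCLM.hasFDerivAt.add (Eᵀ.mulVecCLM.hasFDerivAt.comp γ hx))
  -- The diagonal of C(γ) is constant, so its derivative vanishes; solving this linear equation for
  -- X = dx/dγ gives `hX`.
  have hD : E.mulVecCLM ∘L A.mulVecCLM ∘L (P.mulVecCLM + Eᵀ.mulVecCLM ∘L X) = 0 := by
    refine (E.mulVecCLM.hasFDerivAt.comp γ hv).unique ?_
    refine (hasFDerivAt_const (1 : Fin n → ℝ) γ).congr_of_eventuallyEq (.of_forall fun δ => ?_)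
    exact elimD_mulVec_vecExp_logDiag δ
  have hX : ∀ v, X v = -((E * A * Eᵀ)⁻¹ *ᵥ (E *ᵥ (A *ᵥ (P *ᵥ v)))) := by
    intro v
    have h := congr((E * A * Eᵀ)⁻¹ *ᵥ $hD v)
    simp only [ContinuousLinearMap.comp_apply, _root_.add_apply,
      Matrix.mulVecCLM_apply, _root_.zero_apply, Matrix.mulVec_add,
      Matrix.mulVec_zero] at h
    rw [Matrix.mulVec_mulVec (X v), Matrix.mulVec_mulVec (X v), ← Matrix.mul_assoc,
      Matrix.mulVec_mulVec (X v), Matrix.nonsing_inv_mul _ hdet, Matrix.one_mulVec] at h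
    exact eq_neg_of_add_eq_zero_right h
  have hL : HasFDerivAt rhoOf
      ((elimL n).mulVecCLM ∘L A.mulVecCLM ∘L (P.mulVecCLM + Eᵀ.mulVecCLM ∘L X)) γ :=
    ((elimL n).mulVecCLM.hasFDerivAt.comp γ hv).congr_of_eventuallyEq
      (.of_forall fun δ => (elimL_mulVec_vecExp_logDiag δ).symm)
  convert hL using 1
  ext1 v
  simp only [ContinuousLinearMap.comp_apply, _root_.add_apply,
    Matrix.mulVecCLM_apply, hX, ← Matrix.mulVec_mulVec, Matrix.sub_mulVec, Matrix.one_mulVec,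
    Matrix.mulVec_neg, Matrix.mulVec_sub, ← sub_eq_add_neg]

theorem proposition3 (n : ℕ) :
    Set.BijOn gammaOf (corrSet n) Set.univ ∧
    ∀ γ : LowerIndex n → ℝ,
      DifferentiableAt ℝ vecExp (matLog (corrOf γ)).vec ∧
      IsUnit (elimD n * expJacobian (matLog (corrOf γ)) * (elimD n).transpose) ∧
      DifferentiableAt ℝ rhoOf γ ∧
      jacobian rhoOf γ =
        elimL n *
          (1 - expJacobian (matLog (corrOf γ)) * (elimD n).transpose *
            (elimD n * expJacobian (matLog (corrOf γ)) * (elimD n).transpose)⁻¹ * elimD n) *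
          expJacobian (matLog (corrOf γ)) * (elimL n + elimU n).transpose :=
  ⟨bijOn_gammaOf, fun γ => ⟨(hasStrictFDerivAt_vecExp _).hasFDerivAt.differentiableAt,
    isUnit_elimD_mul_expJacobian_mul (isHermitian_matLog _),
    (hasFDerivAt_rhoOf γ).differentiableAt, jacobian_eq_of_hasFDerivAt (hasFDerivAt_rhoOf γ)⟩⟩
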